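/- In the problem $1||\sum p_jU_j$ the input consists of $n\ge 1$ jobs $1,\dots,n$, where job $j$ has an integer processing time $p_j\ge 1$ and an integer due date $d_j\ge 0$. A schedule is a permutation $\sigma$ of $\{1,\dots,n\}$; the completion time of job $j$ under $\sigma$ is $C_j=\sum_{i:\,\sigma(i)\le\sigma(j)}p_i$, and $U_j=1$ if $C_j>d_j$ (job $j$ is tardy) and $U_j=0$ otherwise. The task is to determine the minimum of $\sum_j p_jU_j$, the total processing time of the tardy jobs, over all schedules. Let $P=\sum_j p_j$. Theorem. The problem $1||\sum p_jU_j$ can be solved in $\tilde O(P^{7/4})$ time. That is, there are a single deterministic word-RAM program and constants $C$, $k$ such that on every instance the program halts after at most $C\,P^{7/4}(1+\log P)^k$ steps and outputs the minimum of $\sum_j p_jU_j$ over all schedules. Here a machine word has $O(\log(P+\max_j d_j+2))$ bits, and each arithmetic operation ($+$, truncated $-$, $\times$, integer division, remainder), comparison and memory access on words takes one step. -/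

import Mathlib

/-! ## The scheduling problem `1 || ∑ p_j U_j`

Jobs are the elements of `Fin n`; job `j` has processing time `p j` and due date `d j`.
A schedule is a permutation `σ`, where `σ j` is the position of job `j`. -/

namespace Scheduling

/-- Completion time of job `j` under the schedule `σ`: the total processing time of the jobs
that do not come after `j` (including `j` itself). -/
def completionTime {n : ℕ} (p : Fin n → ℕ) (σ : Equiv.Perm (Fin n)) (j : Fin n) : ℕ :=
  ∑ i with σ i ≤ σ j, p i

/-- The indicator `U_j`: it is `1` if job `j` is tardy under `σ`, and `0` if it is early. -/
def tardyIndicator {n : ℕ} (p d : Fin n → ℕ) (σ : Equiv.Perm (Fin n)) (j : Fin n) : ℕ :=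
  if d j < completionTime p σ j then 1 else 0

/-- The objective `∑ p_j U_j`: the total processing time of the tardy jobs under `σ`. -/
def tardyTime {n : ℕ} (p d : Fin n → ℕ) (σ : Equiv.Perm (Fin n)) : ℕ :=
  ∑ j, p j * tardyIndicator p d σ j

/-- The total processing time `P` of all jobs. -/
def totalTime {n : ℕ} (p : Fin n → ℕ) : ℕ := ∑ j, p j

end Scheduling

/-! ## A word RAM with a step count

Programs are finite texts of a structured language. They work on registers and on a random access
memory that is divided into arrays. Register names and array names are literals of the program
text, so a program uses only finitely many of them, and only the index of an array cell is computed
at run time (this is the usual random access memory with the arrays interleaved).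

All values (contents, indices, intermediate results) are natural numbers below a bound `W`, the
number of machine words. The program does not depend on `W`. An overflow is not wrapped around:
a computation in which a value `≥ W` would appear has no result at all. -/

namespace RAM

/-- The unit-time operations on words. -/
inductive BinOp where
  | add | sub | mul | div | mod | lt | eq

/-- The meaning of the operations: `sub` is truncated at `0`, division by zero gives `0`,
`x mod 0 = x`, and comparisons give `1` (true) or `0` (false). -/
def BinOp.eval : BinOp → ℕ → ℕ → ℕ
  | .add, x, y => x + y
  | .sub, x, y => x - y
  | .mul, x, y => x * y
  | .div, x, y => x / y
  | .mod, x, y => x % y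
  | .lt, x, y => if x < y then 1 else 0
  | .eq, x, y => if x = y then 1 else 0

/-- A configuration: the contents of the registers, and the contents of the cells of the arrays. -/
structure State where
  reg : ℕ → ℕ
  arr : ℕ → ℕ → ℕ

/-- Write `v` into register `x`. -/
def State.setReg (s : State) (x v : ℕ) : State :=
  { s with reg := Function.update s.reg x v }

/-- Write `v` into cell `i` of array `a`. -/
def State.setArr (s : State) (a i v : ℕ) : State :=
  { s with arr := Function.update s.arr a (Function.update (s.arr a) i v) }

/-- Expressions: constants, register contents, array cells with a computed index, operations. -/
inductive Expr where
  | const (c : ℕ)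
  | reg (x : ℕ)
  | read (a : ℕ) (i : Expr)
  | bin (o : BinOp) (e₁ e₂ : Expr)

/-- The value of an expression in a configuration. -/
def Expr.val (s : State) : Expr → ℕ
  | .const c => c
  | .reg x => s.reg x
  | .read a i => s.arr a (i.val s)
  | .bin o e₁ e₂ => o.eval (e₁.val s) (e₂.val s)

/-- Every value that appears in the evaluation of the expression is a machine word. -/
def Expr.Fits (W : ℕ) (s : State) : Expr → Prop
  | .const c => c < W
  | .reg x => s.reg x < W
  | .read a i => i.Fits W s ∧ s.arr a (i.val s) < W
  | .bin o e₁ e₂ => e₁.Fits W s ∧ e₂.Fits W s ∧ o.eval (e₁.val s) (e₂.val s) < W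

/-- The time to evaluate an expression: one step for every constant, register access,
memory access and operation in it. -/
def Expr.cost : Expr → ℕ
  | .const _ => 1
  | .reg _ => 1
  | .read _ i => i.cost + 1
  | .bin _ e₁ e₂ => e₁.cost + e₂.cost + 1

/-- Programs. A condition holds if its value is not `0`. -/
inductive Prog where
  | skip
  | assign (x : ℕ) (e : Expr)
  | store (a : ℕ) (i e : Expr)
  | seq (c₁ c₂ : Prog)
  | ite (b : Expr) (c₁ c₂ : Prog)
  | loop (b : Expr) (c : Prog)

/-- `Exec W c s t s'`: started in `s`, the program `c` halts in `s'` after exactly `t` steps,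
and all values that appear on the way are below `W`. -/
inductive Exec (W : ℕ) : Prog → State → ℕ → State → Prop where
  | skip (s : State) : Exec W .skip s 1 s
  | assign (s : State) (x : ℕ) (e : Expr) (he : e.Fits W s) :
      Exec W (.assign x e) s (e.cost + 1) (s.setReg x (e.val s))
  | store (s : State) (a : ℕ) (i e : Expr) (hi : i.Fits W s) (he : e.Fits W s) :
      Exec W (.store a i e) s (i.cost + e.cost + 1) (s.setArr a (i.val s) (e.val s))
  | seq {c₁ c₂ : Prog} {s s₁ s₂ : State} {t₁ t₂ : ℕ}
      (h₁ : Exec W c₁ s t₁ s₁) (h₂ : Exec W c₂ s₁ t₂ s₂) :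
      Exec W (.seq c₁ c₂) s (t₁ + t₂) s₂
  | iteTrue {b : Expr} {c₁ c₂ : Prog} {s s₁ : State} {t : ℕ}
      (hb : b.Fits W s) (hv : b.val s ≠ 0) (h : Exec W c₁ s t s₁) :
      Exec W (.ite b c₁ c₂) s (b.cost + 1 + t) s₁
  | iteFalse {b : Expr} {c₁ c₂ : Prog} {s s₁ : State} {t : ℕ}
      (hb : b.Fits W s) (hv : b.val s = 0) (h : Exec W c₂ s t s₁) :
      Exec W (.ite b c₁ c₂) s (b.cost + 1 + t) s₁
  | loopDone {b : Expr} {c : Prog} {s : State}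
      (hb : b.Fits W s) (hv : b.val s = 0) :
      Exec W (.loop b c) s (b.cost + 1) s
  | loopStep {b : Expr} {c : Prog} {s s₁ s₂ : State} {t₁ t₂ : ℕ}
      (hb : b.Fits W s) (hv : b.val s ≠ 0)
      (h₁ : Exec W c s t₁ s₁) (h₂ : Exec W (.loop b c) s₁ t₂ s₂) :
      Exec W (.loop b c) s (b.cost + 1 + t₁ + t₂) s₂

end RAM

namespace Scheduling

/-- The input convention: register `0` holds the number `n` of jobs, array `0` holds the processing
times and array `1` the due dates in the cells `0, …, n - 1`; everything else is `0`. -/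
def inputState {n : ℕ} (p d : Fin n → ℕ) : RAM.State where
  reg := fun x => if x = 0 then n else 0
  arr := fun a i =>
    if h : i < n then
      if a = 0 then p ⟨i, h⟩ else if a = 1 then d ⟨i, h⟩ else 0
    else 0

/-- The number of machine words if a word has about `κ * log₂ (P + max d_j)` bits, that is,
a constant times the number of bits of the numbers in the input. -/
def wordBound {n : ℕ} (κ : ℕ) (p d : Fin n → ℕ) : ℕ :=
  (totalTime p + Finset.univ.sup d + 2) ^ κ

end Scheduling

/-! Minimising the tardy time means maximising the total `x` of a set of jobs that can all be early.
Due dates may be cut at `P`, and a set can be early exactly when, for every `D`, its jobs due by `D`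
have total at most `D` (earliest due date first). So if the jobs are taken by nondecreasing due
date, a job with time `q` and due date `D` turns the set `X` of reachable totals into `X ∪ {y + q |
y ∈ X, y + q ≤ D}` (`reach_insert`), and the answer is `P - max X`.

Scanning all of `X` for each job would be too slow; the saving comes from treating equal processing
times together. `X` is kept as an append-only log. For each value `q` two counters record what
earlier jobs of that length achieved: every entry among the first `a q` of the log whose value is
below `t q` already has its translate by `q` in `X` (`Good`). Since due dates never decrease, a new
job only has to visit the log entries beyond `a q` and the values from `t q` up to `D - q`. Both
counters only move forward and stay at most `P + 1`, so all jobs of length `q` together cost `O(P)`,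
apart from constant overhead per job (`slack` is the potential).

Distinct positive processing times with sum at most `P` number at most `√(2P)` (`card_image_sq_le`).
With bucket sorting by due date, the total is `O(P^(3/2))`, within the claimed bound without any
logarithm. -/

namespace RAM

/-! ### Program logic with step counts -/

/-- `Runs W c s Q`: started in `s`, the program `c` halts, and `Q` holds of the number of steps
and the final configuration. -/
def Runs (W : ℕ) (c : Prog) (s : State) (Q : ℕ → State → Prop) : Prop :=
  ∃ t s', Exec W c s t s' ∧ Q t s'

variable {W : ℕ} {s : State} {Q : ℕ → State → Prop}

theorem Runs.mono {c : Prog} {Q' : ℕ → State → Prop} (h : Runs W c s Q)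
    (hQ : ∀ t s', Q t s' → Q' t s') : Runs W c s Q' := by
  obtain ⟨t, s', he, hq⟩ := h
  exact ⟨t, s', he, hQ _ _ hq⟩

theorem Runs.skip (h : Q 1 s) : Runs W .skip s Q := ⟨_, _, .skip s, h⟩

theorem Runs.assign {x : ℕ} {e : Expr} (he : e.Fits W s)
    (h : Q (e.cost + 1) (s.setReg x (e.val s))) : Runs W (.assign x e) s Q :=
  ⟨_, _, .assign s x e he, h⟩

theorem Runs.store {a : ℕ} {i e : Expr} (hi : i.Fits W s) (he : e.Fits W s)
    (h : Q (i.cost + e.cost + 1) (s.setArr a (i.val s) (e.val s))) :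
    Runs W (.store a i e) s Q :=
  ⟨_, _, .store s a i e hi he, h⟩

theorem Runs.seq {c₁ c₂ : Prog}
    (h : Runs W c₁ s fun t₁ s₁ => Runs W c₂ s₁ fun t₂ s₂ => Q (t₁ + t₂) s₂) :
    Runs W (.seq c₁ c₂) s Q := by
  obtain ⟨t₁, s₁, h₁, t₂, s₂, h₂, hq⟩ := h
  exact ⟨_, _, .seq h₁ h₂, hq⟩

theorem Runs.ite {b : Expr} {c₁ c₂ : Prog} (hb : b.Fits W s)
    (h₁ : b.val s ≠ 0 → Runs W c₁ s fun t s' => Q (b.cost + 1 + t) s')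
    (h₂ : b.val s = 0 → Runs W c₂ s fun t s' => Q (b.cost + 1 + t) s') :
    Runs W (.ite b c₁ c₂) s Q := by
  by_cases hv : b.val s = 0
  · obtain ⟨t, s', h, hq⟩ := h₂ hv
    exact ⟨_, _, .iteFalse hb hv h, hq⟩
  · obtain ⟨t, s', h, hq⟩ := h₁ hv
    exact ⟨_, _, .iteTrue hb hv h, hq⟩

/-- The rule for loops with an invariant `I` and a potential `φ` that pays for the steps. -/
theorem Runs.loop {b : Expr} {c : Prog} (I : State → Prop) (φ : State → ℕ)
    (hb : ∀ s, I s → b.Fits W s)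
    (hstep : ∀ s, I s → b.val s ≠ 0 →
      Runs W c s fun t s' => I s' ∧ t + b.cost + 1 + φ s' ≤ φ s)
    (hs : I s) :
    Runs W (.loop b c) s fun t s' => I s' ∧ b.val s' = 0 ∧ t + φ s' ≤ φ s + b.cost + 1 := by
  induction hn : φ s using Nat.strong_induction_on generalizing s with
  | _ m ih =>
    by_cases hv : b.val s = 0
    · exact ⟨_, _, .loopDone (hb s hs) hv, hs, hv, by omega⟩
    · obtain ⟨t₁, s₁, h₁, hI, ht⟩ := hstep s hs hv
      -- Testing the condition costs at least one step, so the potential strictly decreases and the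
      -- induction applies.
      obtain ⟨t₂, s₂, h₂, hI₂, hv₂, ht₂⟩ := ih (φ s₁) (by omega) hI rfl
      exact ⟨_, _, .loopStep (hb s hs) hv h₁ h₂, hI₂, hv₂, by omega⟩

end RAM

namespace Scheduling

/-! ### Feasible sets of early jobs -/

/-- `x` is the total processing time of a set `S ⊆ J` of jobs that can all be early. -/
def Reach {ι : Type*} (p d : ι → ℕ) (J : Finset ι) (x : ℕ) : Prop :=
  ∃ S ⊆ J, ∑ i ∈ S, p i = x ∧ ∀ D, ∑ i ∈ S with d i ≤ D, p i ≤ D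

theorem reach_empty {ι : Type*} (p d : ι → ℕ) (x : ℕ) : Reach p d ∅ x ↔ x = 0 := by
  constructor
  · rintro ⟨S, hS, rfl, -⟩
    simp [Finset.subset_empty.1 hS]
  · rintro rfl
    exact ⟨∅, by simp⟩

/-- Since `j` has the latest due date, adding it leaves the constraints below `d j` untouched, and
all constraints from `d j` on follow from the one bounding the whole sum by `d j`. -/
theorem reach_insert {ι : Type*} [DecidableEq ι] (p d : ι → ℕ) {J : Finset ι} {j : ι}
    (hj : j ∉ J) (hd : ∀ i ∈ J, d i ≤ d j) (x : ℕ) :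
    Reach p d (insert j J) x ↔
      Reach p d J x ∨ ∃ y, Reach p d J y ∧ x = y + p j ∧ x ≤ d j := by
  constructor
  · rintro ⟨S, hS, rfl, hf⟩
    by_cases hjS : j ∈ S
    · right
      have hsum := Finset.sum_erase_add S p hjS
      refine ⟨∑ i ∈ S.erase j, p i, ⟨S.erase j, ?_, rfl, fun D => ?_⟩, hsum.symm, ?_⟩
      · exact Finset.subset_insert_iff.1 hS
      · exact (Finset.sum_le_sum_of_subset
          (Finset.filter_subset_filter _ (Finset.erase_subset _ _))).trans (hf D)
      · convert hf (d j) using 1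
        rw [Finset.filter_true_of_mem]
        intro i hi
        rcases Finset.mem_insert.1 (hS hi) with rfl | h
        · exact le_rfl
        · exact hd i h
    · left
      exact ⟨S, (Finset.subset_insert_iff_of_notMem hjS).1 hS, rfl, hf⟩
  · rintro (⟨S, hS, rfl, hf⟩ | ⟨y, ⟨S, hS, rfl, hf⟩, rfl, hle⟩)
    · exact ⟨S, hS.trans (Finset.subset_insert _ _), rfl, hf⟩
    · have hjS : j ∉ S := fun h => hj (hS h)
      refine ⟨insert j S, Finset.insert_subset_insert _ hS, ?_, fun D => ?_⟩
      · rw [Finset.sum_insert hjS, add_comm]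
      · by_cases hD : d j ≤ D
        · refine (Finset.sum_le_sum_of_subset (Finset.filter_subset _ _)).trans ?_
          rw [Finset.sum_insert hjS, add_comm]
          exact hle.trans hD
        · rw [Finset.filter_insert, if_neg hD]
          exact hf D

theorem tardyTime_add_early {n : ℕ} (p d : Fin n → ℕ) (σ : Equiv.Perm (Fin n)) :
    tardyTime p d σ + ∑ j with completionTime p σ j ≤ d j, p j = totalTime p := by
  rw [tardyTime, totalTime, Finset.sum_filter, ← Finset.sum_add_distrib]
  refine Finset.sum_congr rfl fun j _ => ?_
  simp only [tardyIndicator]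
  split_ifs <;> omega

/-- The early jobs of a schedule meet all due dates on their own. -/
theorem reach_early {n : ℕ} (p d : Fin n → ℕ) (σ : Equiv.Perm (Fin n)) :
    Reach p (fun j => min (d j) (totalTime p)) Finset.univ
      (∑ j with completionTime p σ j ≤ d j, p j) := by
  refine ⟨_, Finset.subset_univ _, rfl, fun D => ?_⟩
  set T := ({i ∈ ({j | completionTime p σ j ≤ d j} : Finset (Fin n)) |
    min (d i) (totalTime p) ≤ D} : Finset (Fin n)) with hT
  rcases T.eq_empty_or_nonempty with h | h
  · simp [h]
  -- The job of `T` scheduled last completes after all of `T`, yet by its own due date, which after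
  -- the cut is at most `D`.
  · obtain ⟨j, hj, hmax⟩ := T.exists_max_image σ h
    have h1 : ∑ i ∈ T, p i ≤ completionTime p σ j :=
      Finset.sum_le_sum_of_subset fun i hi => by simpa using hmax i hi
    have h2 : ∑ i ∈ T, p i ≤ totalTime p := Finset.sum_le_sum_of_subset (Finset.subset_univ _)
    simp only [hT, Finset.mem_filter, Finset.mem_univ, true_and] at hj
    omega

/-- A reachable total is attained by the early jobs of a schedule. -/
theorem exists_schedule_of_reach {n : ℕ} (p d : Fin n → ℕ) {x : ℕ}
    (h : Reach p (fun j => min (d j) (totalTime p)) Finset.univ x) :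
    ∃ σ : Equiv.Perm (Fin n), tardyTime p d σ + x ≤ totalTime p := by
  classical
  obtain ⟨S, -, rfl, hf⟩ := h
  -- Sorting by this key puts the chosen jobs first, by cut due date; the key `totalTime p + 1`
  -- exceeds every cut due date. Other jobs may happen to be early too, whence only an inequality.
  let f : Fin n → ℕ := fun j => if j ∈ S then min (d j) (totalTime p) else totalTime p + 1
  have hmono := Tuple.monotone_sort f
  refine ⟨(Tuple.sort f).symm, ?_⟩
  rw [← tardyTime_add_early p d (Tuple.sort f).symm]
  refine Nat.add_le_add_left (Finset.sum_le_sum_of_subset fun j hj => ?_) _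
  simp only [Finset.mem_filter, Finset.mem_univ, true_and]
  have hfj : f j = min (d j) (totalTime p) := if_pos hj
  refine le_trans (Finset.sum_le_sum_of_subset fun i hi => ?_)
    ((hf (min (d j) (totalTime p))).trans (min_le_left _ _))
  simp only [Finset.mem_filter, Finset.mem_univ, true_and] at hi
  have hle := hmono hi
  simp only [Function.comp, Equiv.apply_symm_apply] at hle
  rw [hfj] at hle
  by_cases hiS : i ∈ S
  · have hfi : f i = min (d i) (totalTime p) := if_pos hiS
    rw [hfi] at hle
    exact Finset.mem_filter.2 ⟨hiS, hle⟩
  · have hfi : f i = totalTime p + 1 := if_neg hiS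
    omega

theorem isLeast_tardyTime {n : ℕ} (p d : Fin n → ℕ) {x : ℕ}
    (hx : Reach p (fun j => min (d j) (totalTime p)) Finset.univ x)
    (hmax : ∀ y, Reach p (fun j => min (d j) (totalTime p)) Finset.univ y → y ≤ x) :
    IsLeast (Set.range (tardyTime p d)) (totalTime p - x) := by
  have hlow : ∀ σ, totalTime p - x ≤ tardyTime p d σ := fun σ => by
    have h1 := hmax _ (reach_early p d σ)
    have h2 := tardyTime_add_early p d σ
    omega
  refine ⟨?_, ?_⟩
  · obtain ⟨σ, hσ⟩ := exists_schedule_of_reach p d hx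
    have := hlow σ
    exact ⟨σ, by omega⟩
  · rintro _ ⟨σ, rfl⟩
    exact hlow σ

/-- Passes between the jobs in `Fin n` and the memory arrays, which are indexed by `ℕ`. -/
theorem reach_range_iff {n : ℕ} (p d : ℕ → ℕ) (x : ℕ) :
    Reach p d (Finset.range n) x ↔
      Reach (fun j : Fin n => p j) (fun j => d j) Finset.univ x := by
  constructor
  · rintro ⟨S, hS, rfl, hf⟩
    have key : ∀ T ⊆ S, ∑ i ∈ Finset.univ.filter (fun j : Fin n => (j : ℕ) ∈ T), p i
        = ∑ i ∈ T, p i := fun T hT => by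
      refine Finset.sum_bij (fun j _ => (j : ℕ)) ?_ ?_ ?_ ?_
      · simp
      · intro a _ b _ h
        exact Fin.ext h
      · intro i hi
        exact ⟨⟨i, Finset.mem_range.1 (hS (hT hi))⟩, by simpa using hi, rfl⟩
      · simp
    refine ⟨Finset.univ.filter (fun j : Fin n => (j : ℕ) ∈ S), Finset.subset_univ _,
      key S subset_rfl, fun D => ?_⟩
    refine le_trans (le_of_eq ?_) (hf D)
    rw [← key _ (Finset.filter_subset _ _), Finset.filter_filter]
    simp
  · rintro ⟨S, -, rfl, hf⟩
    refine ⟨S.map Fin.valEmbedding, fun i hi => ?_, by simp, fun D => ?_⟩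
    · obtain ⟨j, -, rfl⟩ := Finset.mem_map.1 hi
      simp
    · rw [Finset.filter_map, Finset.sum_map]
      exact hf D

/-! ### The number of distinct processing times -/

/-- Distinct positive numbers have a sum that is at least quadratic in their number. -/
theorem card_sq_le_two_mul_sum (Q : Finset ℕ) (hQ : ∀ q ∈ Q, 0 < q) :
    Q.card ^ 2 ≤ 2 * ∑ q ∈ Q, q := by
  induction Q using Finset.induction_on_max with
  | empty => simp
  | insert m s hm ih =>
    have hs : m ∉ s := fun h => lt_irrefl _ (hm m h)
    have h1 := ih fun q hq => hQ q (Finset.mem_insert_of_mem hq)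
    have h2 : s.card + 1 ≤ m := by
      have hsub : s ⊆ Finset.Ico 1 m := fun q hq =>
        Finset.mem_Ico.2 ⟨hQ q (Finset.mem_insert_of_mem hq), hm q hq⟩
      have := Finset.card_le_card hsub
      have h0 := hQ m (Finset.mem_insert_self _ _)
      rw [Nat.card_Ico] at this
      omega
    rw [Finset.card_insert_of_notMem hs, Finset.sum_insert hs]
    nlinarith

/-- One job for each occurring processing time already accounts for the sum of the distinct values.
-/
theorem card_image_sq_le {n : ℕ} (p : ℕ → ℕ) (hp : ∀ i < n, 0 < p i) :
    ((Finset.range n).image p).card ^ 2 ≤ 2 * ∑ i ∈ Finset.range n, p i := by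
  refine (card_sq_le_two_mul_sum _ fun q hq => ?_).trans (Nat.mul_le_mul_left 2 ?_)
  · obtain ⟨i, hi, rfl⟩ := Finset.mem_image.1 hq
    exact hp i (Finset.mem_range.1 hi)
  · exact Finset.sum_image_le_of_nonneg (f := fun q => q) (fun _ _ => Nat.zero_le _)

end Scheduling
namespace Scheduling
open RAM

/-! ### The append-only log of reachable totals -/

/-- The log of the reachable totals: cell `x` of `pos` is one more than the place of `x` in the
list `log` of length `len`, or `0` if `x` is not in the list; `mx` is the largest entry. -/
structure LogOK (P : ℕ) (pos log : ℕ → ℕ) (len mx : ℕ) : Prop where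
  pos_log : ∀ i < len, pos (log i) = i + 1
  log_pos : ∀ x, pos x ≠ 0 → pos x ≤ len ∧ log (pos x - 1) = x ∧ x ≤ mx
  pos_mx : pos mx ≠ 0
  mx_le : mx ≤ P

theorem LogOK.le {P : ℕ} {pos log : ℕ → ℕ} {len mx : ℕ} (h : LogOK P pos log len mx)
    {x : ℕ} (hx : pos x ≠ 0) : x ≤ P := (h.log_pos x hx).2.2.trans h.mx_le

/-- The entries are distinct, because `pos` recovers the index, and they lie in `[0, P]`. -/
theorem LogOK.len_le {P : ℕ} {pos log : ℕ → ℕ} {len mx : ℕ} (h : LogOK P pos log len mx) :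
    len ≤ P + 1 := by
  have := Finset.card_le_card_of_injOn (s := Finset.range len) (t := Finset.range (P + 1)) log
    (fun i hi => by
      have h1 := h.pos_log i (by simpa using hi)
      have h2 := h.le (x := log i) (by omega)
      simp only [Finset.coe_range, Set.mem_Iio]
      omega)
    (fun i hi j hj hij => by
      have h1 := h.pos_log i (by simpa using hi)
      have h2 := h.pos_log j (by simpa using hj)
      rw [hij] at h1
      omega)
  simpa using this

theorem LogOK.pos_le {P : ℕ} {pos log : ℕ → ℕ} {len mx : ℕ} (h : LogOK P pos log len mx)
    (x : ℕ) : pos x ≤ P + 1 := by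
  by_cases hx : pos x = 0
  · omega
  · exact (h.log_pos x hx).1.trans h.len_le

theorem LogOK.insert {P : ℕ} {pos log : ℕ → ℕ} {len mx y : ℕ} (h : LogOK P pos log len mx)
    (hy : y ≤ P) (h0 : pos y = 0) :
    LogOK P (Function.update pos y (len + 1)) (Function.update log len y) (len + 1)
      (max mx y) := by
  refine ⟨fun i hi => ?_, fun x hx => ?_, ?_, max_le h.mx_le hy⟩
  · by_cases hil : i = len
    · subst hil
      simp
    · have h1 := h.pos_log i (by omega)
      have hne : log i ≠ y := fun he => by
        rw [he] at h1
        omega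
      simp [hil, hne, h1]
  · by_cases hxy : x = y
    · subst hxy
      simp
    · rw [Function.update_of_ne hxy] at hx ⊢
      obtain ⟨h1, h2, h3⟩ := h.log_pos x hx
      rw [Function.update_of_ne (by omega)]
      exact ⟨by omega, h2, h3.trans (le_max_left _ _)⟩
  · by_cases hm : max mx y = y
    · simp [hm]
    · have hm' : max mx y = mx := by omega
      rw [hm'] at hm ⊢
      rw [Function.update_of_ne hm]
      exact h.pos_mx

/-- Insert the content of register `8` into the log, if it is not there. -/
def insertSum : Prog :=
  .ite (.read 4 (.reg 8)) .skip
    (.seq (.store 5 (.reg 4) (.reg 8))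
    (.seq (.assign 4 (.bin .add (.reg 4) (.const 1)))
    (.seq (.store 4 (.reg 8) (.reg 4))
      (.ite (.bin .lt (.reg 5) (.reg 8)) (.assign 5 (.reg 8)) .skip))))

/-- The effect of `insertSum` with `y` in register `8`. -/
structure Inserted (P y : ℕ) (s s' : State) : Prop where
  log : LogOK P (s'.arr 4) (s'.arr 5) (s'.reg 4) (s'.reg 5)
  mem : ∀ x, s'.arr 4 x ≠ 0 ↔ s.arr 4 x ≠ 0 ∨ x = y
  old : ∀ x, s.arr 4 x ≠ 0 → s'.arr 4 x = s.arr 4 x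
  late : ∀ x, s.arr 4 x = 0 → s'.arr 4 x ≠ 0 → s.reg 4 < s'.arr 4 x
  len_le : s.reg 4 ≤ s'.reg 4
  regs : ∀ k, k ≠ 4 → k ≠ 5 → s'.reg k = s.reg k
  arrs : ∀ k, k ≠ 4 → k ≠ 5 → s'.arr k = s.arr k

theorem Inserted.of_update {P y : ℕ} {s s' : State} (hy : y ≤ P)
    (h : LogOK P (s.arr 4) (s.arr 5) (s.reg 4) (s.reg 5)) (h0 : s.arr 4 y = 0)
    (r4 : s'.reg 4 = s.reg 4 + 1) (r5 : s'.reg 5 = max (s.reg 5) y)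
    (a4 : s'.arr 4 = Function.update (s.arr 4) y (s.reg 4 + 1))
    (a5 : s'.arr 5 = Function.update (s.arr 5) (s.reg 4) y)
    (regs : ∀ k, k ≠ 4 → k ≠ 5 → s'.reg k = s.reg k)
    (arrs : ∀ k, k ≠ 4 → k ≠ 5 → s'.arr k = s.arr k) : Inserted P y s s' := by
  refine ⟨?_, fun x => ?_, fun x hx => ?_, fun x h1 h2 => ?_, by omega, regs, arrs⟩
  · rw [r4, r5, a4, a5]
    exact h.insert hy h0
  · by_cases hxy : x = y <;> simp [a4, hxy]
  · have hxy : x ≠ y := fun he => hx (he ▸ h0)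
    simp [a4, hxy]
  · by_cases hxy : x = y
    · simp [a4, hxy]
    · simp [a4, hxy, h1] at h2

theorem runs_insertSum {W P y : ℕ} {s : State} (hW : 2 * P + 4 ≤ W)
    (h : LogOK P (s.arr 4) (s.arr 5) (s.reg 4) (s.reg 5)) (h8 : s.reg 8 = y) (hy : y ≤ P) :
    Runs W insertSum s fun t s' => t ≤ 30 ∧ Inserted P y s s' := by
  have hlen := h.len_le
  have hpos := h.pos_le y
  have hmx := h.mx_le
  refine Runs.ite (by simp only [Expr.Fits, Expr.val, h8]; omega) (fun hv => ?_) (fun hv => ?_)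
  · simp only [Expr.val, h8] at hv
    refine Runs.skip ⟨by simp [Expr.cost], h, fun x => ?_, fun _ _ => rfl,
      fun x h1 h2 => absurd h1 h2, le_rfl, fun _ _ _ => rfl, fun _ _ _ => rfl⟩
    constructor
    · exact Or.inl
    · rintro (h | rfl)
      exacts [h, hv]
  · simp only [Expr.val, h8] at hv
    have hins := h.insert hy hv
    refine Runs.seq (Runs.store ?_ ?_ (Runs.seq (Runs.assign ?_ (Runs.seq (Runs.store ?_ ?_
      (Runs.ite ?_ (fun hc => Runs.assign ?_ ?_) (fun hc => Runs.skip ?_)))))))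
    any_goals
      simp [Expr.Fits, Expr.val, BinOp.eval, State.setReg, State.setArr, h8]
      try omega
    · split_ifs <;> omega
    all_goals
      simp [Expr.val, BinOp.eval, State.setReg, State.setArr, h8] at hc
      refine ⟨by simp [Expr.cost], .of_update hy h hv ?_ ?_ ?_ ?_ ?_ ?_⟩
    all_goals
      simp +contextual [State.setReg, State.setArr, Expr.val, BinOp.eval, h8]
    · exact hc.le
    · exact hc

/-! ### The two counters of each processing time -/

/-- All jobs with processing time `q` so far have taken care of the first `a q` entries of the log
that are below `t q`. -/
structure Good (P D : ℕ) (pos log a t : ℕ → ℕ) (len mx : ℕ) : Prop where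
  log : LogOK P pos log len mx
  a_le : ∀ q, a q ≤ len
  t_le : ∀ q, t q ≤ D + 1 - q
  closed : ∀ q x, pos x ≠ 0 → pos x ≤ a q → x < t q → pos (x + q) ≠ 0

/-- Advancing the log counter brings a single new entry, `log (a q)`, under the closure condition;
it matters only if its value is below `t q`. -/
theorem Good.bump_a {P D q : ℕ} {pos log a t : ℕ → ℕ} {len mx : ℕ}
    (h : Good P D pos log a t len mx) (hq : a q < len)
    (hc : log (a q) < t q → pos (log (a q) + q) ≠ 0) :
    Good P D pos log (Function.update a q (a q + 1)) t len mx := by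
  refine ⟨h.log, fun q' => ?_, h.t_le, fun q' x hx hxa hxt => ?_⟩
  · by_cases hqq : q' = q
    · subst hqq
      simpa using hq
    · simpa [hqq] using h.a_le q'
  · by_cases hqq : q' = q
    · subst hqq
      rw [Function.update_self] at hxa
      by_cases hle : pos x ≤ a q'
      · exact h.closed q' x hx hle hxt
      · have h2 := (h.log.log_pos x hx).2.1
        have h3 : pos x - 1 = a q' := by omega
        rw [h3] at h2
        rw [h2] at hc
        exact hc hxt
    · rw [Function.update_of_ne hqq] at hxa
      exact h.closed q' x hx hxa hxt

/-- Dually, the only new value is `t q`; it matters only if it stands among the first `a q` entries.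
-/
theorem Good.bump_t {P D q : ℕ} {pos log a t : ℕ → ℕ} {len mx : ℕ}
    (h : Good P D pos log a t len mx) (hq : t q + q < D + 1)
    (hc : pos (t q) ≠ 0 → pos (t q) ≤ a q → pos (t q + q) ≠ 0) :
    Good P D pos log a (Function.update t q (t q + 1)) len mx := by
  refine ⟨h.log, h.a_le, fun q' => ?_, fun q' x hx hxa hxt => ?_⟩
  · by_cases hqq : q' = q
    · subst hqq
      rw [Function.update_self]
      omega
    · simpa [hqq] using h.t_le q'
  · by_cases hqq : q' = q
    · subst hqq
      rw [Function.update_self] at hxt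
      by_cases hlt : x < t q'
      · exact h.closed q' x hx hxa hlt
      · have h3 : x = t q' := by omega
        subst h3
        exact hc hx hxa
    · rw [Function.update_of_ne hqq] at hxt
      exact h.closed q' x hx hxa hxt

/-- The state `s` arises from `s₀` by insertions of sums `y + q ≤ D` of old entries `y`. -/
structure Grown (P D q : ℕ) (s₀ s : State) : Prop where
  good : Good P D (s.arr 4) (s.arr 5) (s.arr 6) (s.arr 7) (s.reg 4) (s.reg 5)
  regs : ∀ k, k ≠ 4 → k ≠ 5 → k ≠ 8 → s.reg k = s₀.reg k
  arrs : ∀ k < 4, s.arr k = s₀.arr k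
  old : ∀ x, s₀.arr 4 x ≠ 0 → s.arr 4 x = s₀.arr 4 x
  new : ∀ x, s.arr 4 x ≠ 0 → s₀.arr 4 x ≠ 0 ∨ ∃ y, s₀.arr 4 y ≠ 0 ∧ x = y + q ∧ x ≤ D
  len_le : s₀.reg 4 ≤ s.reg 4

/-- Old entries keep their places and no place holds two values, so the length of the log at the
start of the job separates old totals from new ones. This prevents the job from being used twice. -/
theorem Grown.old_of_le {P D q : ℕ} {s₀ s : State} (h : Grown P D q s₀ s)
    (h₀ : LogOK P (s₀.arr 4) (s₀.arr 5) (s₀.reg 4) (s₀.reg 5)) {x : ℕ} (hx : s.arr 4 x ≠ 0)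
    (hle : s.arr 4 x ≤ s₀.reg 4) : s₀.arr 4 x ≠ 0 := by
  have h1 := h₀.pos_log (s.arr 4 x - 1) (by omega)
  have h2 := h.old _ (by rw [h1]; omega)
  have h3 := (h.good.log.log_pos x hx).2.1
  have h4 := (h.good.log.log_pos (s₀.arr 5 (s.arr 4 x - 1)) (by rw [h2, h1]; omega)).2.1
  rw [h2, h1, Nat.add_sub_cancel, h3] at h4
  rw [← h4] at h1
  omega

/-- An inserted total gets a place beyond every counter `a q'`, so the closure conditions of all
processing times survive. -/
theorem Grown.insert {P D q y : ℕ} {s₀ s s₁ s' : State} (h : Grown P D q s₀ s)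
    (hs₁ : s₁ = s.setReg 8 y) (hy : ∃ x, s₀.arr 4 x ≠ 0 ∧ y = x + q ∧ y ≤ D)
    (hi : Inserted P y s₁ s') : Grown P D q s₀ s' ∧ s'.arr 6 = s.arr 6 ∧ s'.arr 7 = s.arr 7 := by
  subst hs₁
  have h6 : s'.arr 6 = s.arr 6 := hi.arrs 6 (by decide) (by decide)
  have h7 : s'.arr 7 = s.arr 7 := hi.arrs 7 (by decide) (by decide)
  have hlen : s.reg 4 ≤ s'.reg 4 := hi.len_le
  refine ⟨⟨⟨hi.log, fun q => ?_, fun q => ?_, fun q' x hx hxa hxt => ?_⟩, fun k h4 h5 h8 => ?_,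
    fun k hk => ?_, fun x hx => ?_, fun x hx => ?_, h.len_le.trans hlen⟩, h6, h7⟩
  · rw [h6]
    exact (h.good.a_le q).trans hlen
  · rw [h7]
    exact h.good.t_le q
  · rw [h6] at hxa
    rw [h7] at hxt
    have hxs : s.arr 4 x ≠ 0 := fun h0 => by
      have h1 : s.reg 4 < s'.arr 4 x := hi.late x h0 hx
      have h2 := h.good.a_le q'
      omega
    have he : s'.arr 4 x = s.arr 4 x := hi.old x hxs
    rw [he] at hxa
    exact (hi.mem _).2 (Or.inl (h.good.closed q' x hxs hxa hxt))
  · rw [hi.regs k h4 h5, ← h.regs k h4 h5 h8]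
    simp [State.setReg, h8]
  · rw [← h.arrs k hk]
    exact hi.arrs k (by omega) (by omega)
  · rw [← h.old x hx]
    exact hi.old x (by rw [← h.old x hx] at hx; exact hx)
  · rcases (hi.mem x).1 hx with h1 | rfl
    · exact h.new x h1
    · exact Or.inr hy

/-- The unused part of the counters of the processing times in `Q`. -/
def slack (Q : Finset ℕ) (P : ℕ) (s : State) : ℕ :=
  ∑ q ∈ Q, ((P + 1 - s.arr 6 q) + (P + 1 - s.arr 7 q))

theorem slack_bump {Q : Finset ℕ} {P q : ℕ} {s s' : State} (hq : q ∈ Q)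
    (h : ∀ q' ≠ q, s'.arr 6 q' = s.arr 6 q' ∧ s'.arr 7 q' = s.arr 7 q')
    (hlt : (P + 1 - s'.arr 6 q) + (P + 1 - s'.arr 7 q) <
      (P + 1 - s.arr 6 q) + (P + 1 - s.arr 7 q)) : slack Q P s' + 1 ≤ slack Q P s := by
  refine Nat.succ_le_of_lt (Finset.sum_lt_sum (fun q' _ => ?_) ⟨q, hq, hlt⟩)
  by_cases hqq : q' = q
  · subst hqq
    exact hlt.le
  · rw [(h q' hqq).1, (h q' hqq).2]

/-! ### The two loops that handle one job -/

/-- Go through the new entries of the log. -/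
def logLoop : Prog :=
  .loop (.bin .lt (.read 6 (.reg 6)) (.reg 7))
    (.seq (.assign 8 (.bin .add (.read 5 (.read 6 (.reg 6))) (.reg 6)))
    (.seq (.ite (.bin .lt (.reg 8) (.bin .add (.reg 2) (.const 1))) insertSum .skip)
      (.store 6 (.reg 6) (.bin .add (.read 6 (.reg 6)) (.const 1)))))

/-- Go through the entries that have come below the due date. -/
def valueLoop : Prog :=
  .loop (.bin .lt (.bin .add (.read 7 (.reg 6)) (.reg 6)) (.bin .add (.reg 2) (.const 1)))
    (.seq (.assign 8 (.read 4 (.read 7 (.reg 6))))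
    (.seq (.ite (.reg 8)
        (.ite (.bin .lt (.reg 8) (.bin .add (.reg 7) (.const 1)))
          (.seq (.assign 8 (.bin .add (.read 7 (.reg 6)) (.reg 6))) insertSum) .skip) .skip)
      (.store 7 (.reg 6) (.bin .add (.read 7 (.reg 6)) (.const 1)))))

theorem Grown.setReg {P D q v : ℕ} {s₀ s : State} (h : Grown P D q s₀ s) :
    Grown P D q s₀ (s.setReg 8 v) :=
  ⟨h.good, fun k h4 h5 h8 => by rw [← h.regs k h4 h5 h8]; simp [State.setReg, h8],
    h.arrs, h.old, h.new, h.len_le⟩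

/-- Each round advances `a q` and so lowers the slack by one, which pays 100 steps. A sum above `D`
may be skipped: `t q ≤ D + 1 - q`, so nothing is claimed for that entry until the value counter
passes it. -/
theorem runs_logLoop {W P D q : ℕ} {Q : Finset ℕ} {s₀ s : State} (hW : 2 * P + 4 ≤ W)
    (hD : D ≤ P) (hqP : q ≤ P) (hq : q ∈ Q)
    (h₀ : LogOK P (s₀.arr 4) (s₀.arr 5) (s₀.reg 4) (s₀.reg 5))
    (h2 : s₀.reg 2 = D) (h6 : s₀.reg 6 = q) (h7 : s₀.reg 7 = s₀.reg 4)
    (hs : Grown P D q s₀ s) (hsa : s.arr 6 q ≤ s₀.reg 4) :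
    Runs W logLoop s fun t s' => (Grown P D q s₀ s' ∧ s'.arr 6 q = s₀.reg 4) ∧
      t + 100 * slack Q P s' ≤ 100 * slack Q P s + 10 := by
  refine Runs.mono (Runs.loop (fun s => Grown P D q s₀ s ∧ s.arr 6 q ≤ s₀.reg 4)
    (fun s => 100 * slack Q P s) ?_ ?_ ⟨hs, hsa⟩) ?_
  · rintro s ⟨hg, ha⟩
    have e6 : s.reg 6 = q := (hg.regs 6 (by decide) (by decide) (by decide)).trans h6
    have e7 : s.reg 7 = s₀.reg 4 := (hg.regs 7 (by decide) (by decide) (by decide)).trans h7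
    have := h₀.len_le
    simp only [Expr.Fits, Expr.val, BinOp.eval, e6, e7]
    split_ifs <;> omega
  · rintro s ⟨hg, ha⟩ hv
    have e2 : s.reg 2 = D := (hg.regs 2 (by decide) (by decide) (by decide)).trans h2
    have e6 : s.reg 6 = q := (hg.regs 6 (by decide) (by decide) (by decide)).trans h6
    have e7 : s.reg 7 = s₀.reg 4 := (hg.regs 7 (by decide) (by decide) (by decide)).trans h7
    have hlen₀ := h₀.len_le
    have hv' : s.arr 6 q < s₀.reg 4 := by
      simpa [Expr.val, BinOp.eval, e6, e7] using hv
    have hlt : s.arr 6 q < s.reg 4 := hv'.trans_le hg.len_le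
    have hpl := hg.good.log.pos_log _ hlt
    have hx : s.arr 5 (s.arr 6 q) ≤ P := hg.good.log.le (by omega)
    have hx₀ : s₀.arr 4 (s.arr 5 (s.arr 6 q)) ≠ 0 := hg.old_of_le h₀ (by omega) (by omega)
    -- The counter update, common to both branches; 70 of the 100 steps released are reserved for
    -- the rest of the round.
    have key : ∀ s₂, Grown P D q s₀ s₂ → s₂.arr 6 = s.arr 6 → s₂.arr 7 = s.arr 7 →
        (s.arr 5 (s.arr 6 q) + q ≤ D → s₂.arr 4 (s.arr 5 (s.arr 6 q) + q) ≠ 0) →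
        Runs W (.store 6 (.reg 6) (.bin .add (.read 6 (.reg 6)) (.const 1))) s₂ fun t₂ s' =>
          (Grown P D q s₀ s' ∧ s'.arr 6 q ≤ s₀.reg 4) ∧
          t₂ + 70 + 100 * slack Q P s' ≤ 100 * slack Q P s := by
      intro s₂ hg₂ a6 a7 hmem
      have e6' : s₂.reg 6 = q := (hg₂.regs 6 (by decide) (by decide) (by decide)).trans h6
      have hlt₂ : s₂.arr 6 q < s₂.reg 4 := by rw [a6]; exact hv'.trans_le hg₂.len_le
      have hlog : s₂.arr 5 (s₂.arr 6 q) = s.arr 5 (s.arr 6 q) := by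
        have h1 := hg₂.old _ hx₀
        have h3 := (hg₂.good.log.log_pos _ (by rw [h1]; exact hx₀)).2.1
        rw [h1, ← hg.old _ hx₀, hpl, Nat.add_sub_cancel] at h3
        rw [a6]
        exact h3
      have hbump := hg₂.good.bump_a (q := q) hlt₂ (fun hl => by
        rw [hlog] at hl ⊢
        have := hg₂.good.t_le q
        exact hmem (by omega))
      refine Runs.store ?_ ?_ ⟨⟨⟨?_, ?_, ?_, ?_, ?_, ?_⟩, ?_⟩, ?_⟩
      · simp only [Expr.Fits, e6']
        omega
      · simp only [Expr.Fits, Expr.val, BinOp.eval, e6', a6]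
        omega
      · simpa [State.setArr, Expr.val, BinOp.eval, e6'] using hbump
      · exact hg₂.regs
      · intro k hk
        rw [← hg₂.arrs k hk]
        exact Function.update_of_ne (show k ≠ 6 by omega) _ _
      · exact hg₂.old
      · exact hg₂.new
      · exact hg₂.len_le
      · simp [State.setArr, Expr.val, BinOp.eval, e6', a6]
        omega
      · have hsl := slack_bump (P := P) (s := s) (s' := s₂.setArr 6
          (Expr.val s₂ (.reg 6)) (Expr.val s₂ (.bin .add (.read 6 (.reg 6)) (.const 1)))) hq
          (fun q' hq' => by simp [State.setArr, Expr.val, e6', hq', a6, a7])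
          (by simp [State.setArr, Expr.val, BinOp.eval, e6', a6, a7]; omega)
        simp only [Expr.cost]
        omega
    refine Runs.seq (Runs.assign ?_ (Runs.seq (Runs.ite ?_ (fun hc => ?_) (fun hc => ?_))))
    · simp only [Expr.Fits, Expr.val, BinOp.eval, e6]
      omega
    · simp [Expr.Fits, Expr.val, BinOp.eval, e6, State.setReg, e2]
      split_ifs <;> omega
    · have hc' : s.arr 5 (s.arr 6 q) + q < D + 1 := by
        simpa [Expr.val, BinOp.eval, State.setReg, e6, e2] using hc
      refine Runs.mono (runs_insertSum hW (y := s.arr 5 (s.arr 6 q) + q) hg.good.log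
        (by simp [State.setReg, Expr.val, BinOp.eval, e6]) (by omega)) ?_
      rintro t s₂ ⟨ht, hi⟩
      obtain ⟨hg₂, a6, a7⟩ := hg.insert (by simp [Expr.val, BinOp.eval, e6])
        ⟨_, hx₀, rfl, by omega⟩ hi
      refine (key s₂ hg₂ a6 a7 fun _ => (hi.mem _).2 (Or.inr rfl)).mono ?_
      rintro t₂ s' ⟨hI, ht₂⟩
      refine ⟨hI, ?_⟩
      simp only [Expr.cost]
      omega
    · have hc' : D + 1 ≤ s.arr 5 (s.arr 6 q) + q := by
        simpa [Expr.val, BinOp.eval, State.setReg, e6, e2] using hc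
      refine Runs.skip ?_
      refine (key _ hg.setReg rfl rfl fun h => ?_).mono ?_
      · omega
      rintro t₂ s' ⟨hI, ht₂⟩
      refine ⟨hI, ?_⟩
      simp only [Expr.cost]
      omega
  · rintro t s' ⟨⟨hg, ha⟩, hv, ht⟩
    have e6 : s'.reg 6 = q := (hg.regs 6 (by decide) (by decide) (by decide)).trans h6
    have e7 : s'.reg 7 = s₀.reg 4 := (hg.regs 7 (by decide) (by decide) (by decide)).trans h7
    have hv' : s₀.reg 4 ≤ s'.arr 6 q := by
      simpa [Expr.val, BinOp.eval, e6, e7] using hv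
    refine ⟨⟨hg, le_antisymm ha hv'⟩, ht.trans ?_⟩
    simp only [Expr.cost]
    omega

/-- Here `t q` advances until `D < t q + q`. The place of each value is compared with the log length
saved in register `7`, so only totals present before this job are extended. -/
theorem runs_valueLoop {W P D q : ℕ} {Q : Finset ℕ} {s₀ s : State} (hW : 2 * P + 4 ≤ W)
    (hD : D ≤ P) (hqP : q ≤ P) (hq : q ∈ Q)
    (h₀ : LogOK P (s₀.arr 4) (s₀.arr 5) (s₀.reg 4) (s₀.reg 5))
    (h2 : s₀.reg 2 = D) (h6 : s₀.reg 6 = q) (h7 : s₀.reg 7 = s₀.reg 4)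
    (hs : Grown P D q s₀ s) (hsa : s.arr 6 q = s₀.reg 4) :
    Runs W valueLoop s fun t s' =>
      (Grown P D q s₀ s' ∧ s'.arr 6 q = s₀.reg 4 ∧ D < s'.arr 7 q + q) ∧
      t + 100 * slack Q P s' ≤ 100 * slack Q P s + 10 := by
  refine Runs.mono (Runs.loop (fun s => Grown P D q s₀ s ∧ s.arr 6 q = s₀.reg 4)
    (fun s => 100 * slack Q P s) ?_ ?_ ⟨hs, hsa⟩) ?_
  · rintro s ⟨hg, ha⟩
    have e2 : s.reg 2 = D := (hg.regs 2 (by decide) (by decide) (by decide)).trans h2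
    have e6 : s.reg 6 = q := (hg.regs 6 (by decide) (by decide) (by decide)).trans h6
    have := hg.good.t_le q
    simp only [Expr.Fits, Expr.val, BinOp.eval, e6, e2]
    split_ifs <;> omega
  · rintro s ⟨hg, ha⟩ hv
    have e2 : s.reg 2 = D := (hg.regs 2 (by decide) (by decide) (by decide)).trans h2
    have e6 : s.reg 6 = q := (hg.regs 6 (by decide) (by decide) (by decide)).trans h6
    have e7 : s.reg 7 = s₀.reg 4 := (hg.regs 7 (by decide) (by decide) (by decide)).trans h7
    have hlen₀ := h₀.len_le
    have hv' : s.arr 7 q + q < D + 1 := by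
      simpa [Expr.val, BinOp.eval, e6, e2] using hv
    have hpos := hg.good.log.pos_le (s.arr 7 q)
    have key : ∀ s₂, Grown P D q s₀ s₂ → s₂.arr 6 = s.arr 6 → s₂.arr 7 = s.arr 7 →
        (s₀.arr 4 (s.arr 7 q) ≠ 0 → s₂.arr 4 (s.arr 7 q + q) ≠ 0) →
        Runs W (.store 7 (.reg 6) (.bin .add (.read 7 (.reg 6)) (.const 1))) s₂ fun t₂ s' =>
          (Grown P D q s₀ s' ∧ s'.arr 6 q = s₀.reg 4) ∧
          t₂ + 70 + 100 * slack Q P s' ≤ 100 * slack Q P s := by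
      intro s₂ hg₂ a6 a7 hmem
      have e6' : s₂.reg 6 = q := (hg₂.regs 6 (by decide) (by decide) (by decide)).trans h6
      have hbump := hg₂.good.bump_t (q := q) (by rw [a7]; exact hv') (fun hx hl => by
        rw [a6, ha] at hl
        have := hg₂.old_of_le h₀ hx hl
        rw [a7] at this ⊢
        exact hmem this)
      refine Runs.store ?_ ?_ ⟨⟨⟨?_, ?_, ?_, ?_, ?_, ?_⟩, ?_⟩, ?_⟩
      · simp only [Expr.Fits, e6']
        omega
      · simp only [Expr.Fits, Expr.val, BinOp.eval, e6', a7]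
        omega
      · simpa [State.setArr, Expr.val, BinOp.eval, e6'] using hbump
      · exact hg₂.regs
      · intro k hk
        rw [← hg₂.arrs k hk]
        exact Function.update_of_ne (show k ≠ 7 by omega) _ _
      · exact hg₂.old
      · exact hg₂.new
      · exact hg₂.len_le
      · simp [State.setArr, a6, ha]
      · have hsl := slack_bump (P := P) (s := s) (s' := s₂.setArr 7
          (Expr.val s₂ (.reg 6)) (Expr.val s₂ (.bin .add (.read 7 (.reg 6)) (.const 1)))) hq
          (fun q' hq' => by simp [State.setArr, Expr.val, e6', hq', a6, a7])
          (by simp [State.setArr, Expr.val, BinOp.eval, e6', a6, a7]; omega)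
        simp only [Expr.cost]
        omega
    refine Runs.seq (Runs.assign ?_ (Runs.seq (Runs.ite ?_ (fun hc => Runs.ite ?_
      (fun hc2 => Runs.seq (Runs.assign ?_ ?_)) (fun hc2 => Runs.skip ?_))
      (fun hc => Runs.skip ?_))))
    · simp only [Expr.Fits, Expr.val, e6]
      omega
    · simp [Expr.Fits, Expr.val, e6, State.setReg]
      omega
    · simp [Expr.Fits, Expr.val, BinOp.eval, e6, State.setReg, e7]
      split_ifs <;> omega
    · simp [Expr.Fits, Expr.val, BinOp.eval, e6, State.setReg]
      omega
    · have hc' : s.arr 4 (s.arr 7 q) ≠ 0 := by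
        simpa [Expr.val, State.setReg, e6] using hc
      have hc2' : s.arr 4 (s.arr 7 q) < s₀.reg 4 + 1 := by
        simpa [Expr.val, BinOp.eval, State.setReg, e6, e7] using hc2
      have hx₀ := hg.old_of_le h₀ hc' (by omega)
      refine Runs.mono (runs_insertSum hW (y := s.arr 7 q + q) hg.good.log
        (by simp [State.setReg, Expr.val, BinOp.eval, e6]) (by omega)) ?_
      rintro t s₂ ⟨ht, hi⟩
      obtain ⟨hg₂, a6, a7⟩ := (hg.setReg (v := s.arr 4 (s.arr 7 q))).insert
        (by simp [Expr.val, BinOp.eval, State.setReg, e6]) ⟨_, hx₀, rfl, by omega⟩ hi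
      refine (key s₂ hg₂ a6 a7 fun _ => (hi.mem _).2 (Or.inr rfl)).mono ?_
      rintro t₂ s' ⟨hI, ht₂⟩
      refine ⟨hI, ?_⟩
      simp only [Expr.cost]
      omega
    · have hc2' : s₀.reg 4 + 1 ≤ s.arr 4 (s.arr 7 q) := by
        simpa [Expr.val, BinOp.eval, State.setReg, e6, e7] using hc2
      refine (key _ hg.setReg rfl rfl fun h => ?_).mono ?_
      -- A place beyond the saved length belongs to a total created by this very job, so the value
      -- is not an old one.
      · have h1 := hg.old _ h
        have h3 := (h₀.log_pos _ h).1
        omega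
      rintro t₂ s' ⟨hI, ht₂⟩
      refine ⟨hI, ?_⟩
      simp only [Expr.cost]
      omega
    · have hc' : s.arr 4 (s.arr 7 q) = 0 := by
        simpa [Expr.val, State.setReg, e6] using hc
      refine (key _ hg.setReg rfl rfl fun h => ?_).mono ?_
      · have h1 := hg.old _ h
        omega
      rintro t₂ s' ⟨hI, ht₂⟩
      refine ⟨hI, ?_⟩
      simp only [Expr.cost]
      omega
  · rintro t s' ⟨⟨hg, ha⟩, hv, ht⟩
    have e2 : s'.reg 2 = D := (hg.regs 2 (by decide) (by decide) (by decide)).trans h2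
    have e6 : s'.reg 6 = q := (hg.regs 6 (by decide) (by decide) (by decide)).trans h6
    have hv' : D + 1 ≤ s'.arr 7 q + q := by
      simpa [Expr.val, BinOp.eval, e6, e2] using hv
    refine ⟨⟨hg, ha, hv'⟩, ht.trans ?_⟩
    simp only [Expr.cost]
    omega

end Scheduling
namespace RAM

theorem BinOp.eval_lt_lt {W : ℕ} (hW : 1 < W) (x y : ℕ) : BinOp.eval .lt x y < W := by
  simp only [BinOp.eval]
  split_ifs <;> omega

end RAM

namespace Scheduling
open RAM

/-! ### The update of the reachable totals by one job -/

/-- Handle the job whose successor number is in register `3`, at the due date in register `2`, and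
go to the next job with this due date. -/
def jobStep : Prog :=
  .seq (.assign 6 (.read 0 (.bin .sub (.reg 3) (.const 1))))
    (.seq (.assign 7 (.reg 4))
    (.seq logLoop
    (.seq valueLoop
      (.assign 3 (.read 3 (.bin .sub (.reg 3) (.const 1)))))))

/-- After both loops, an old `y` with `y + q ≤ D` has place at most `a q` and value below `t q`, so
closure supplies `y + q`, perhaps through an earlier job's work. The slack is carried over from job
to job, which makes the cost amortised. -/
theorem runs_jobStep {W P D q j : ℕ} {Q : Finset ℕ} {s : State} (hW : 2 * P + 4 ≤ W)
    (hD : D ≤ P) (hqP : q ≤ P) (hq : q ∈ Q) (hj : j < P)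
    (h2 : s.reg 2 = D) (h3 : s.reg 3 = j + 1) (hp : s.arr 0 j = q) (hnext : s.arr 3 j ≤ P)
    (hs : Good P D (s.arr 4) (s.arr 5) (s.arr 6) (s.arr 7) (s.reg 4) (s.reg 5)) :
    Runs W jobStep s fun t s' =>
      Good P D (s'.arr 4) (s'.arr 5) (s'.arr 6) (s'.arr 7) (s'.reg 4) (s'.reg 5) ∧
      (∀ x, s'.arr 4 x ≠ 0 ↔
        s.arr 4 x ≠ 0 ∨ ∃ y, s.arr 4 y ≠ 0 ∧ x = y + q ∧ x ≤ D) ∧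
      (∀ k < 3, s'.reg k = s.reg k) ∧ s'.reg 3 = s.arr 3 j ∧
      (∀ k < 4, s'.arr k = s.arr k) ∧
      t + 100 * slack Q P s' ≤ 100 * slack Q P s + 60 := by
  have hlen := hs.log.len_le
  -- The reference state for old entries: `q` is loaded and the current length of the log is saved.
  let s₀ : State := (s.setReg 6 q).setReg 7 (s.reg 4)
  have hg₀ : Grown P D q s₀ s₀ :=
    ⟨hs, fun _ _ _ _ => rfl, fun _ _ => rfl, fun _ _ => rfl, fun _ => Or.inl, le_rfl⟩
  have hv6 : Expr.val s (.read 0 (.bin .sub (.reg 3) (.const 1))) = q := by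
    simp [Expr.val, BinOp.eval, h3, hp]
  refine Runs.seq (Runs.assign ?_ (Runs.seq (Runs.assign ?_ (Runs.seq ?_))))
  · simp [Expr.Fits, Expr.val, BinOp.eval, h3, hp]
    omega
  · simp [Expr.Fits, State.setReg]
    omega
  rw [hv6]
  refine Runs.mono (runs_logLoop (s₀ := s₀) (s := s₀) hW hD hqP hq hs.log h2 rfl rfl hg₀
    (hs.a_le q)) ?_
  rintro t₁ s₁ ⟨⟨hg₁, ha₁⟩, ht₁⟩
  refine Runs.seq (Runs.mono (runs_valueLoop (s₀ := s₀) hW hD hqP hq hs.log h2 rfl rfl hg₁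
    ha₁) ?_)
  rintro t₂ s₂ ⟨⟨hg₂, ha₂, hd₂⟩, ht₂⟩
  have e3 : s₂.reg 3 = j + 1 := (hg₂.regs 3 (by decide) (by decide) (by decide)).trans h3
  have a3 : s₂.arr 3 j = s.arr 3 j := congrFun (hg₂.arrs 3 (by decide)) j
  refine Runs.assign ?_ ⟨hg₂.good, fun x => ⟨hg₂.new x, ?_⟩, fun k hk => ?_, ?_,
    fun k hk => hg₂.arrs k hk, ?_⟩
  · simp [Expr.Fits, Expr.val, BinOp.eval, e3, a3]
    omega
  · rintro (hx | ⟨y, hy, rfl, hle⟩)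
    · have h1 : s₂.arr 4 x = s.arr 4 x := hg₂.old x hx
      change s₂.arr 4 x ≠ 0
      rwa [h1]
    · have h1 : s₂.arr 4 y = s.arr 4 y := hg₂.old y hy
      have h4 : s₂.arr 6 q = s.reg 4 := ha₂
      exact hg₂.good.closed q y (by rwa [h1])
        (by rw [h1, h4]; exact (hs.log.log_pos y hy).1) (by omega)
  · have h1 := hg₂.regs k (by omega) (by omega) (by omega)
    simp [State.setReg, show k ≠ 3 by omega, h1, s₀, show k ≠ 6 by omega, show k ≠ 7 by omega]
  · simp [State.setReg, Expr.val, BinOp.eval, e3, a3]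
  · have hsl₀ : slack Q P s₀ = slack Q P s := rfl
    change _ + 100 * slack Q P s₂ ≤ _
    simp only [Expr.cost]
    omega

/-! ### Buckets of equal due dates -/

/-- One more than the last job before `k` with due date `D`, or `0` if there is none. -/
def lastJob (e : ℕ → ℕ) : ℕ → ℕ → ℕ
  | 0, _ => 0
  | k + 1, D => if e k = D then k + 1 else lastJob e k D

theorem lastJob_le (e : ℕ → ℕ) (k D : ℕ) : lastJob e k D ≤ k := by
  induction k with
  | zero => exact le_rfl
  | succ k ih =>
    rw [lastJob]
    split_ifs <;> omega

theorem lastJob_eq (e : ℕ → ℕ) (k D : ℕ) (h : lastJob e k D ≠ 0) :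
    e (lastJob e k D - 1) = D := by
  induction k with
  | zero => exact absurd rfl h
  | succ k ih =>
    rw [lastJob] at h ⊢
    split_ifs at h ⊢ with hk
    · simpa using hk
    · exact ih h

theorem ne_of_lastJob_le (e : ℕ → ℕ) (k D i : ℕ) (h : lastJob e k D ≤ i) (hi : i < k) :
    e i ≠ D := by
  induction k with
  | zero => omega
  | succ k ih =>
    rw [lastJob] at h
    split_ifs at h with hk
    · omega
    · by_cases hik : i = k
      · rwa [hik]
      · exact ih h (by omega)

/-- The jobs handled when the due date `D` and the job pointer `r` are reached. -/
def doneJobs (e : ℕ → ℕ) (n D r : ℕ) : Finset ℕ :=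
  {i ∈ Finset.range n | e i < D ∨ e i = D ∧ r ≤ i}

theorem doneJobs_zero (e : ℕ → ℕ) (n : ℕ) : doneJobs e n 0 (lastJob e n 0) = ∅ := by
  ext i
  simp only [doneJobs, Finset.mem_filter, Finset.mem_range, Finset.notMem_empty, iff_false]
  rintro ⟨hi, h | ⟨h, hr⟩⟩
  · omega
  · exact ne_of_lastJob_le e n 0 i hr hi h

/-- The pointer `0` marks an exhausted bucket, and the head of the next bucket lies above all its
unhandled jobs, so changing buckets handles no job. -/
theorem doneJobs_succ (e : ℕ → ℕ) (n D : ℕ) :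
    doneJobs e n (D + 1) (lastJob e n (D + 1)) = doneJobs e n D 0 := by
  ext i
  simp only [doneJobs, Finset.mem_filter, Finset.mem_range]
  constructor
  · rintro ⟨hi, h | ⟨h, hr⟩⟩
    · exact ⟨hi, by omega⟩
    · exact absurd h (ne_of_lastJob_le e n _ i hr hi)
  · rintro ⟨hi, h⟩
    exact ⟨hi, by omega⟩

/-- Buckets are traversed by decreasing index, and no job strictly between the next one and `j` has
due date `D`. -/
theorem doneJobs_next (e : ℕ → ℕ) {n D j : ℕ} (hj : j < n) (he : e j = D) :
    doneJobs e n D (lastJob e j D) = insert j (doneJobs e n D (j + 1)) := by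
  ext i
  have hle := lastJob_le e j D
  have hne := ne_of_lastJob_le e j D i
  simp only [doneJobs, Finset.mem_filter, Finset.mem_range, Finset.mem_insert]
  by_cases hij : i = j
  · subst hij
    simp [hj, he, hle]
  · simp only [hij, false_or]
    refine and_congr_right fun hi => or_congr_right (and_congr_right fun h => ?_)
    constructor
    · intro hr
      by_contra hlt
      exact hne hr (by omega) h
    · intro hr
      omega

theorem not_mem_doneJobs (e : ℕ → ℕ) {n D j : ℕ} (he : e j = D) :
    j ∉ doneJobs e n D (j + 1) := by
  simp only [doneJobs, Finset.mem_filter]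
  omega

/-! ### The loops of the whole program -/

/-- Compute the total processing time in register `1`. -/
def sumLoop : Prog :=
  .loop (.bin .lt (.reg 2) (.reg 0))
    (.seq (.assign 1 (.bin .add (.reg 1) (.read 0 (.reg 2))))
      (.assign 2 (.bin .add (.reg 2) (.const 1))))

theorem runs_sumLoop {W P n : ℕ} {p : ℕ → ℕ} {s : State} (hW : 2 * P + 4 ≤ W)
    (hP : ∑ i ∈ Finset.range n, p i = P) (hn : n ≤ P)
    (h0 : s.reg 0 = n) (h1 : s.reg 1 = 0) (h2 : s.reg 2 = 0) (h5 : s.reg 5 = 0)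
    (hp : s.arr 0 = p) :
    Runs W sumLoop s fun t s' =>
      (s'.arr = s.arr ∧ s'.reg 0 = n ∧ s'.reg 5 = 0 ∧ s'.reg 1 = P) ∧ t ≤ 100 * n + 10 := by
  have hle : ∀ k ≤ n, ∑ i ∈ Finset.range k, p i ≤ P := fun k hk => by
    rw [← hP]
    exact Finset.sum_le_sum_of_subset (Finset.range_subset_range.2 hk)
  refine Runs.mono (Runs.loop (fun s' => s'.arr = s.arr ∧ s'.reg 0 = n ∧ s'.reg 5 = 0 ∧
    s'.reg 2 ≤ n ∧ s'.reg 1 = ∑ i ∈ Finset.range (s'.reg 2), p i)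
    (fun s' => 100 * (n - s'.reg 2)) ?_ ?_ ⟨rfl, h0, h5, by omega, by simp [h1, h2]⟩) ?_
  · rintro s' ⟨-, e0, e5, e2, -⟩
    refine ⟨?_, ?_, BinOp.eval_lt_lt (by omega) _ _⟩ <;> simp only [Expr.Fits] <;> omega
  · rintro s' ⟨ea, e0, e5, e2, e1⟩ hv
    have hlt : s'.reg 2 < n := by simpa [Expr.val, BinOp.eval, e0] using hv
    have hb := hle (s'.reg 2 + 1) hlt
    rw [Finset.sum_range_succ] at hb
    refine Runs.seq (Runs.assign ?_ (Runs.assign ?_ ⟨⟨ea, ?_, ?_, ?_, ?_⟩, ?_⟩))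
    · simp only [Expr.Fits, Expr.val, BinOp.eval, ea, hp, e1]
      omega
    · simp [Expr.Fits, Expr.val, BinOp.eval, State.setReg]
      omega
    · simpa [State.setReg] using e0
    · simpa [State.setReg] using e5
    · simpa [State.setReg, Expr.val, BinOp.eval] using hlt
    · simp [State.setReg, Expr.val, BinOp.eval, Finset.sum_range_succ, e1, ea, hp]
    · simp [State.setReg, Expr.val, BinOp.eval, Expr.cost]
      omega
  · rintro t s' ⟨⟨ea, e0, e5, e2, e1⟩, hv, ht⟩
    have hle' : n ≤ s'.reg 2 := by simpa [Expr.val, BinOp.eval, e0] using hv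
    have he : s'.reg 2 = n := le_antisymm e2 hle'
    refine ⟨⟨ea, e0, e5, by rw [e1, he, hP]⟩, ?_⟩
    simp only [h2, Expr.cost] at ht
    omega

/-- Link the jobs with the same due date (cut at the content of register `1`). -/
def bucketLoop : Prog :=
  .loop (.bin .lt (.reg 2) (.reg 0))
    (.seq (.ite (.bin .lt (.read 1 (.reg 2)) (.reg 1)) (.assign 3 (.read 1 (.reg 2)))
      (.assign 3 (.reg 1)))
    (.seq (.store 3 (.reg 2) (.read 2 (.reg 3)))
    (.seq (.store 2 (.reg 3) (.bin .add (.reg 2) (.const 1)))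
      (.assign 2 (.bin .add (.reg 2) (.const 1))))))

/-- The first `k` jobs have been linked. -/
structure Bucketed (e : ℕ → ℕ) (k : ℕ) (head next : ℕ → ℕ) : Prop where
  head : ∀ D, head D = lastJob e k D
  next : ∀ j < k, next j = lastJob e j (e j)

/-- Job `k` is put in front of its list, and its link is the former head. -/
theorem Bucketed.succ {e : ℕ → ℕ} {k : ℕ} {head next : ℕ → ℕ} (h : Bucketed e k head next) :
    Bucketed e (k + 1) (Function.update head (e k) (k + 1))
      (Function.update next k (head (e k))) := by
  refine ⟨fun D => ?_, fun j hj => ?_⟩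
  · rw [lastJob]
    by_cases hD : e k = D
    · simp [hD]
    · simp [hD, Ne.symm hD, h.head]
  · by_cases hjk : j = k
    · subst hjk
      simp [h.head]
    · simp [hjk, h.next j (by omega)]

theorem runs_bucketLoop {W P n : ℕ} {d : ℕ → ℕ} {s : State} (hW : 2 * P + 4 ≤ W)
    (hn : n ≤ P) (hd : ∀ i < n, d i < W)
    (h0 : s.reg 0 = n) (h1 : s.reg 1 = P) (h2 : s.reg 2 = 0) (h5 : s.reg 5 = 0)
    (ad : s.arr 1 = d) (ah : ∀ i, s.arr 2 i = 0) :
    Runs W bucketLoop s fun t s' =>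
      (s'.reg 0 = n ∧ s'.reg 1 = P ∧ s'.reg 5 = 0 ∧ (∀ k, k ≠ 2 → k ≠ 3 → s'.arr k = s.arr k) ∧
        Bucketed (fun i => min (d i) P) n (s'.arr 2) (s'.arr 3)) ∧ t ≤ 100 * n + 10 := by
  refine Runs.mono (Runs.loop (fun s' => s'.reg 0 = n ∧ s'.reg 1 = P ∧ s'.reg 5 = 0 ∧
    s'.reg 2 ≤ n ∧ (∀ k, k ≠ 2 → k ≠ 3 → s'.arr k = s.arr k) ∧
    Bucketed (fun i => min (d i) P) (s'.reg 2) (s'.arr 2) (s'.arr 3))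
    (fun s' => 100 * (n - s'.reg 2)) ?_ ?_ ⟨h0, h1, h5, by omega, fun _ _ _ => rfl, ?_⟩) ?_
  · rintro s' ⟨e0, -, -, e2, -⟩
    refine ⟨?_, ?_, BinOp.eval_lt_lt (by omega) _ _⟩ <;> simp only [Expr.Fits] <;> omega
  · rintro s' ⟨e0, e1, e5, e2, ea, hb⟩ hv
    have hlt : s'.reg 2 < n := by simpa [Expr.val, BinOp.eval, e0] using hv
    have a1 : s'.arr 1 = d := (ea 1 (by decide) (by decide)).trans ad
    have hdW := hd _ hlt
    have key : Runs W (.seq (.store 3 (.reg 2) (.read 2 (.reg 3)))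
        (.seq (.store 2 (.reg 3) (.bin .add (.reg 2) (.const 1)))
          (.assign 2 (.bin .add (.reg 2) (.const 1)))))
        (s'.setReg 3 (min (d (s'.reg 2)) P)) fun t s'' =>
        (s''.reg 0 = n ∧ s''.reg 1 = P ∧ s''.reg 5 = 0 ∧ s''.reg 2 ≤ n ∧
          (∀ k, k ≠ 2 → k ≠ 3 → s''.arr k = s.arr k) ∧
          Bucketed (fun i => min (d i) P) (s''.reg 2) (s''.arr 2) (s''.arr 3)) ∧
        t + 30 + 100 * (n - s''.reg 2) ≤ 100 * (n - s'.reg 2) := by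
      have hb' := hb.succ
      have hl := lastJob_le (fun i => min (d i) P) (s'.reg 2) (min (d (s'.reg 2)) P)
      rw [← hb.head] at hl
      refine Runs.seq (Runs.store ?_ ?_ (Runs.seq (Runs.store ?_ ?_ (Runs.assign ?_
        ⟨⟨?_, ?_, ?_, ?_, fun k h2 h3 => ?_, ?_⟩, ?_⟩))))
      · simp [Expr.Fits, State.setReg]
        omega
      · simp [Expr.Fits, Expr.val, State.setReg]
        omega
      · simp [Expr.Fits, State.setReg, State.setArr]
        omega
      · simp [Expr.Fits, Expr.val, BinOp.eval, State.setReg, State.setArr]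
        omega
      · simp [Expr.Fits, Expr.val, BinOp.eval, State.setReg, State.setArr]
        omega
      · simpa [State.setReg, State.setArr] using e0
      · simpa [State.setReg, State.setArr] using e1
      · simpa [State.setReg, State.setArr] using e5
      · simpa [State.setReg, State.setArr, Expr.val, BinOp.eval] using hlt
      · simpa [State.setReg, State.setArr, h2, h3] using ea k h2 h3
      · simpa [State.setReg, State.setArr, Expr.val, BinOp.eval] using hb'
      · simp [State.setReg, State.setArr, Expr.val, BinOp.eval, Expr.cost]
        omega
    refine Runs.seq (Runs.ite ?_ (fun hc => Runs.assign ?_ ?_) (fun hc => Runs.assign ?_ ?_))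
    · simp only [Expr.Fits, Expr.val, BinOp.eval, a1]
      split_ifs <;> omega
    · simp only [Expr.Fits, Expr.val, a1]
      omega
    · have hc' : d (s'.reg 2) < P := by simpa [Expr.val, BinOp.eval, a1, e1] using hc
      have hval : Expr.val s' (.read 1 (.reg 2)) = min (d (s'.reg 2)) P := by
        simp [Expr.val, a1, hc'.le]
      rw [hval]
      refine key.mono ?_
      rintro t s'' ⟨hI, ht⟩
      refine ⟨hI, ?_⟩
      simp only [Expr.cost]
      omega
    · simp only [Expr.Fits]
      omega
    · have hc' : P ≤ d (s'.reg 2) := by simpa [Expr.val, BinOp.eval, a1, e1] using hc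
      have hval : Expr.val s' (.reg 1) = min (d (s'.reg 2)) P := by
        simp [Expr.val, e1, hc']
      rw [hval]
      refine key.mono ?_
      rintro t s'' ⟨hI, ht⟩
      refine ⟨hI, ?_⟩
      simp only [Expr.cost]
      omega
  · rw [h2]
    exact ⟨ah, fun j hj => by omega⟩
  · rintro t s' ⟨⟨e0, e1, e5, e2, ea, hb⟩, hv, ht⟩
    have hle' : n ≤ s'.reg 2 := by simpa [Expr.val, BinOp.eval, e0] using hv
    have he : s'.reg 2 = n := le_antisymm e2 hle'
    rw [he] at hb
    refine ⟨⟨e0, e1, e5, ea, hb⟩, ?_⟩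
    simp only [h2, Expr.cost] at ht
    omega

/-- Handle all jobs in the order of their due dates. -/
def scanLoop : Prog :=
  .loop (.bin .lt (.reg 2) (.bin .add (.reg 1) (.const 1)))
    (.ite (.reg 3) jobStep
      (.seq (.assign 2 (.bin .add (.reg 2) (.const 1))) (.assign 3 (.read 2 (.reg 2)))))

/-- The invariant of `scanLoop`. -/
structure Scan (P n : ℕ) (p e : ℕ → ℕ) (s : State) : Prop where
  reg1 : s.reg 1 = P
  reg2 : s.reg 2 ≤ P + 1
  reg3 : s.reg 3 ≠ 0 → s.reg 3 ≤ n ∧ e (s.reg 3 - 1) = s.reg 2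
  arr0 : s.arr 0 = p
  bucketed : Bucketed e n (s.arr 2) (s.arr 3)
  good : Good P (s.reg 2) (s.arr 4) (s.arr 5) (s.arr 6) (s.arr 7) (s.reg 4) (s.reg 5)
  reach : ∀ x, s.arr 4 x ≠ 0 ↔ Reach p e (doneJobs e n (s.reg 2) (s.reg 3)) x

theorem runs_scanLoop {W P n : ℕ} {p e : ℕ → ℕ} {s : State} (hW : 2 * P + 4 ≤ W)
    (hn : n ≤ P) (hp : ∀ i < n, p i ≤ P) (he : ∀ i, e i ≤ P) (hs : Scan P n p e s) :
    Runs W scanLoop s fun t s' =>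
      (s'.reg 1 = P ∧ s'.reg 5 ≤ P ∧ Reach p e (Finset.range n) (s'.reg 5) ∧
        ∀ x, Reach p e (Finset.range n) x → x ≤ s'.reg 5) ∧
      t ≤ 100 * slack ((Finset.range n).image p) P s + 100 * (P + 1) + 100 * n + 10 := by
  -- The potential adds to the slack the due dates still to come and the jobs still to be handled;
  -- these pay for bucket changes and for the fixed overhead of a job.
  refine Runs.mono (Runs.loop (Scan P n p e) (fun s' =>
    100 * slack ((Finset.range n).image p) P s' + 100 * (P + 1 - s'.reg 2) +
      100 * (n - (doneJobs e n (s'.reg 2) (s'.reg 3)).card)) ?_ ?_ hs) ?_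
  · intro s h
    have := h.reg1
    have := h.reg2
    refine ⟨?_, ?_, BinOp.eval_lt_lt (by omega) _ _⟩ <;>
      simp only [Expr.Fits, Expr.val, BinOp.eval] <;> omega
  · intro s h hv
    have h1 := h.reg1
    have hlt : s.reg 2 < P + 1 := by simpa [Expr.val, BinOp.eval, h1] using hv
    have hcost : (Expr.bin .lt (.reg 2) (.bin .add (.reg 1) (.const 1))).cost = 5 := rfl
    refine Runs.ite ?_ (fun hc => ?_) (fun hc => ?_)
    · by_cases h3 : s.reg 3 = 0
      · simp only [Expr.Fits]
        omega
      · have := (h.reg3 h3).1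
        simp only [Expr.Fits]
        omega
    · obtain ⟨h3, h4⟩ := h.reg3 hc
      obtain ⟨j, hj⟩ := Nat.exists_eq_succ_of_ne_zero hc
      have hj' : s.reg 3 = j + 1 := hj
      rw [hj', Nat.add_sub_cancel] at h4
      have hjn : j < n := by omega
      have hnext := h.bucketed.next j hjn
      have hnle := lastJob_le e j (e j)
      have hins := doneJobs_next e hjn h4
      have hnot := not_mem_doneJobs e (n := n) h4
      refine (runs_jobStep (j := j) (q := p j) (Q := (Finset.range n).image p) hW (by omega)
        (hp j hjn) (Finset.mem_image_of_mem _ (Finset.mem_range.2 hjn)) (by omega) rfl hj'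
        (by rw [h.arr0]) (by omega) h.good).mono ?_
      rintro t s' ⟨hg, hmem, hreg, hr3, harr, ht⟩
      have r1 := hreg 1 (by decide)
      have r2 := hreg 2 (by decide)
      rw [hnext, h4] at hr3
      refine ⟨⟨by rw [r1, h1], by rw [r2]; exact h.reg2, fun h0 => ?_,
        by rw [harr 0 (by decide), h.arr0], ?_, by rw [r2]; exact hg, fun x => ?_⟩, ?_⟩
      · rw [hr3] at h0 ⊢
        rw [r2]
        rw [h4] at hnle
        exact ⟨by omega, lastJob_eq e j _ h0⟩
      · rw [harr 2 (by decide), harr 3 (by decide)]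
        exact h.bucketed
      · rw [r2, hr3, hins, reach_insert p e hnot, hmem, h4]
        · simp only [h.reach, hj']
        · intro i hi
          simp only [doneJobs, Finset.mem_filter] at hi
          omega
      · have hcard : (doneJobs e n (s'.reg 2) (s'.reg 3)).card =
            (doneJobs e n (s.reg 2) (s.reg 3)).card + 1 := by
          rw [r2, hr3, hins, Finset.card_insert_of_notMem hnot, hj']
        have hle : (doneJobs e n (s'.reg 2) (s'.reg 3)).card ≤ n :=
          (Finset.card_le_card (Finset.filter_subset _ _)).trans (Finset.card_range n).le
        rw [hcost, r2]
        rw [r2] at hcard hle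
        simp only [Expr.cost]
        omega
    · have hc' : s.reg 3 = 0 := hc
      have hhead := h.bucketed.head (s.reg 2 + 1)
      have hnle := lastJob_le e n (s.reg 2 + 1)
      have hdone := doneJobs_succ e n (s.reg 2)
      refine Runs.seq (Runs.assign ?_ (Runs.assign ?_ ⟨⟨?_, ?_, fun h0 => ?_, h.arr0, h.bucketed,
        ?_, fun x => ?_⟩, ?_⟩))
      · simp only [Expr.Fits, Expr.val, BinOp.eval]
        omega
      · simp [Expr.Fits, Expr.val, BinOp.eval, State.setReg]
        omega
      · simpa [State.setReg] using h1
      · simp [State.setReg, Expr.val, BinOp.eval]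
        omega
      · simp [State.setReg, Expr.val, BinOp.eval, hhead] at h0 ⊢
        exact ⟨hnle, lastJob_eq e n _ h0⟩
      · refine ⟨h.good.log, h.good.a_le, fun q => (h.good.t_le q).trans ?_, h.good.closed⟩
        simp [State.setReg, Expr.val, BinOp.eval]
        omega
      · have := h.reach x
        rw [hc'] at this
        simpa [State.setReg, Expr.val, BinOp.eval, hhead, hdone] using this
      · have hsl : ∀ v w, slack ((Finset.range n).image p) P ((s.setReg 2 v).setReg 3 w) =
            slack ((Finset.range n).image p) P s := fun _ _ => rfl
        rw [hsl, hcost]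
        simp [State.setReg, Expr.val, BinOp.eval, Expr.cost, hhead, hdone, hc']
        omega
  · rintro t s' ⟨h, hv, ht⟩
    have h1 := h.reg1
    have h2 : s'.reg 2 = P + 1 := by
      have : P + 1 ≤ s'.reg 2 := by simpa [Expr.val, BinOp.eval, h1] using hv
      have := h.reg2
      omega
    -- Cut due dates are at most `P`, so at `P + 1` every job is done.
    have hdone : doneJobs e n (s'.reg 2) (s'.reg 3) = Finset.range n := by
      refine Finset.filter_true_of_mem fun i _ => Or.inl ?_
      have := he i
      omega
    have hreach := h.reach
    rw [hdone] at hreach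
    refine ⟨⟨h1, h.good.log.mx_le, (hreach _).1 h.good.log.pos_mx,
      fun x hx => (h.good.log.log_pos x ((hreach x).2 hx)).2.2⟩, ?_⟩
    simp only [Expr.cost] at ht
    omega

/-- The minimum total processing time of tardy jobs, by going through the reachable totals of
early jobs. -/
def minTardy : Prog :=
  .seq sumLoop
    (.seq (.assign 2 (.const 0))
    (.seq bucketLoop
    (.seq (.store 4 (.const 0) (.const 1))
    (.seq (.assign 4 (.const 1))
    (.seq (.assign 2 (.const 0))
    (.seq (.assign 3 (.read 2 (.const 0)))
    (.seq scanLoop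
      (.assign 0 (.bin .sub (.reg 1) (.reg 5))))))))))

theorem runs_minTardy {W P n : ℕ} {p d : ℕ → ℕ} {s : State} (hW : 2 * P + 4 ≤ W)
    (hP : ∑ i ∈ Finset.range n, p i = P) (hn : n ≤ P) (hd : ∀ i < n, d i < W)
    (h0 : s.reg 0 = n) (hreg : ∀ k ≠ 0, s.reg k = 0) (ap : s.arr 0 = p) (ad : s.arr 1 = d)
    (harr : ∀ k, 2 ≤ k → ∀ i, s.arr k i = 0) :
    Runs W minTardy s fun t s' =>
      (∃ x, s'.reg 0 = P - x ∧ Reach p (fun i => min (d i) P) (Finset.range n) x ∧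
        ∀ y, Reach p (fun i => min (d i) P) (Finset.range n) y → y ≤ x) ∧
      t ≤ 200 * (((Finset.range n).image p).card * (P + 1)) + 100 * (P + 1) + 300 * n + 100 := by
  have hp : ∀ i < n, p i ≤ P := fun i hi => by
    rw [← hP]
    exact Finset.single_le_sum (fun _ _ => Nat.zero_le _) (Finset.mem_range.2 hi)
  refine Runs.seq (Runs.mono (runs_sumLoop hW hP hn h0 (hreg 1 (by decide)) (hreg 2 (by decide))
    (hreg 5 (by decide)) ap) ?_)
  rintro t₁ s₁ ⟨⟨a₁, e0, e5, e1⟩, ht₁⟩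
  refine Runs.seq (Runs.assign ?_ (Runs.seq (Runs.mono (runs_bucketLoop (d := d) hW hn hd
    ?_ ?_ ?_ ?_ ?_ ?_) ?_)))
  · simp only [Expr.Fits]
    omega
  · simpa [State.setReg] using e0
  · simpa [State.setReg] using e1
  · simp [State.setReg, Expr.val]
  · simpa [State.setReg] using e5
  · simpa [State.setReg, a₁] using ad
  · simpa [State.setReg, a₁] using harr 2 le_rfl
  rintro t₂ s₂ ⟨⟨e0, e1, e5, a₂, hb⟩, ht₂⟩
  have a₂' : ∀ k, k ≠ 2 → k ≠ 3 → s₂.arr k = s.arr k := fun k h2 h3 => by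
    rw [a₂ k h2 h3]
    simp [State.setReg, a₁]
  have hhead := hb.head 0
  have hhle := lastJob_le (fun i => min (d i) P) n 0
  have a6 : ∀ q, s₂.arr 6 q = 0 := by
    rw [a₂' 6 (by decide) (by decide)]
    exact harr 6 (by decide)
  have a7 : ∀ q, s₂.arr 7 q = 0 := by
    rw [a₂' 7 (by decide) (by decide)]
    exact harr 7 (by decide)
  have a4 : ∀ q, s₂.arr 4 q = 0 := by
    rw [a₂' 4 (by decide) (by decide)]
    exact harr 4 (by decide)
  have a5 : ∀ q, s₂.arr 5 q = 0 := by
    rw [a₂' 5 (by decide) (by decide)]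
    exact harr 5 (by decide)
  -- The log starts with the total `0` at place 1; cell `0` of the log array already contains `0`.
  -- All counters are `0`, so closure holds vacuously.
  refine Runs.seq (Runs.store ?_ ?_ (Runs.seq (Runs.assign ?_ (Runs.seq (Runs.assign ?_
    (Runs.seq (Runs.assign ?_ (Runs.seq (Runs.mono (runs_scanLoop (n := n) (p := p)
      (e := fun i => min (d i) P) hW hn hp (fun i => min_le_right _ _) ?_) ?_)))))))))
  any_goals
    simp only [Expr.Fits]
    omega
  · simp [Expr.Fits, Expr.val, State.setReg, State.setArr, hhead]
    omega
  · refine ⟨?_, ?_, fun h => ?_, ?_, ?_, ⟨⟨fun i hi => ?_, fun x hx => ?_, ?_, ?_⟩, fun q => ?_,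
      fun q => ?_, fun q x hx hxa hxt => ?_⟩, fun x => ?_⟩
    · simpa [State.setReg, State.setArr] using e1
    · simp [State.setReg, Expr.val]
    · simp only [State.setReg, State.setArr, Expr.val, Function.update_self, ne_eq,
        Nat.reduceEqDiff, not_false_eq_true, Function.update_of_ne,
        hhead] at h ⊢
      exact ⟨hhle, lastJob_eq _ n _ h⟩
    · simpa [State.setReg, State.setArr, a₂'] using ap
    · simpa [State.setReg, State.setArr] using hb
    · have hi0 : i = 0 := by simpa [State.setReg, State.setArr, Expr.val] using hi
      simp [State.setReg, State.setArr, Expr.val, a5, hi0]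
    · have hx0 : x = 0 := by
        by_contra hne
        simp [State.setReg, State.setArr, Expr.val, hne, a4] at hx
      simp [State.setReg, State.setArr, Expr.val, a5, hx0]
    · simp [State.setReg, State.setArr, Expr.val, e5]
    · simp [State.setReg, State.setArr, Expr.val, e5]
    · simp [State.setReg, State.setArr, a6]
    · simp [State.setReg, State.setArr, a7]
    · simp [State.setReg, State.setArr, a7] at hxt
    · simp only [State.setReg, State.setArr, Expr.val, Function.update_self, ne_eq,
        Nat.reduceEqDiff, not_false_eq_true, Function.update_of_ne,
        hhead, doneJobs_zero, reach_empty]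
      by_cases hx : x = 0 <;> simp [hx, a4]
  · rintro t₃ s₃ ⟨⟨r1, r5, hr, hmax⟩, ht₃⟩
    refine Runs.assign ?_ ⟨⟨s₃.reg 5, ?_, hr, hmax⟩, ?_⟩
    · simp only [Expr.Fits, Expr.val, BinOp.eval]
      omega
    · simp [State.setReg, Expr.val, BinOp.eval, r1]
    · have hsl : slack ((Finset.range n).image p) P s₂ =
          2 * (((Finset.range n).image p).card * (P + 1)) := by
        simp only [slack, a6, a7, Finset.sum_const, smul_eq_mul]
        rw [Nat.sub_zero]
        ring
      have hsl' : ∀ i v x y z, slack ((Finset.range n).image p) P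
          (((((s₂.setArr 4 i v).setReg 4 x).setReg 2 y).setReg 3 z)) =
          slack ((Finset.range n).image p) P s₂ := fun _ _ _ _ _ => rfl
      rw [hsl', hsl] at ht₃
      simp only [Expr.cost]
      omega

end Scheduling
-- The running time and the conclusion
namespace Scheduling

theorem time_bound {P n m t : ℕ} (hP : 1 ≤ P) (hn : n ≤ P) (hm : m ^ 2 ≤ 2 * P)
    (ht : t ≤ 200 * (m * (P + 1)) + 100 * (P + 1) + 300 * n + 100) :
    (t : ℝ) ≤ 1400 * (P : ℝ) ^ (7 / 4 : ℝ) := by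
  have hP' : (1 : ℝ) ≤ P := by exact_mod_cast hP
  have hn' : (n : ℝ) ≤ P := by exact_mod_cast hn
  have hm' : (m : ℝ) ^ 2 ≤ 2 * P := by exact_mod_cast hm
  have ht' : (t : ℝ) ≤ 200 * (m * (P + 1)) + 100 * (P + 1) + 300 * n + 100 := by
    exact_mod_cast ht
  set r : ℝ := (P : ℝ) ^ (3 / 4 : ℝ) with hr
  have hr1 : 1 ≤ r := Real.one_le_rpow hP' (by norm_num)
  have hrr : (P : ℝ) ≤ r ^ 2 := by
    rw [hr, ← Real.rpow_natCast, ← Real.rpow_mul (by positivity)]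
    calc (P : ℝ) = (P : ℝ) ^ (1 : ℝ) := (Real.rpow_one _).symm
      _ ≤ _ := Real.rpow_le_rpow_of_exponent_le hP' (by norm_num)
  -- From `m² ≤ 2P ≤ 2r²`; the weak estimate `P ≤ r²` is enough for the exponent `7/4`.
  have hmr : (m : ℝ) ≤ 2 * r := by
    refine le_of_sq_le_sq ?_ (by positivity)
    nlinarith
  have hpow : (P : ℝ) ^ (7 / 4 : ℝ) = P * r := by
    rw [hr, ← Real.rpow_one_add' (by positivity) (by norm_num)]
    norm_num
  rw [hpow]
  have h1 : (P : ℝ) ≤ P * r := le_mul_of_one_le_right (by positivity) hr1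
  have h2 : (m : ℝ) * (P + 1) ≤ 2 * r * (2 * P) :=
    mul_le_mul hmr (by linarith) (by positivity) (by positivity)
  -- The constant is `200 · 4` from the main term and `200 + 300 + 100` from the others.
  linarith

end Scheduling

theorem theorem3 :
    ∃ (A : RAM.Prog) (κ k : ℕ) (C : ℝ),
      ∀ (n : ℕ) (p d : Fin n → ℕ), 0 < n → (∀ j, 0 < p j) →
        ∃ (t : ℕ) (s : RAM.State),
          RAM.Exec (Scheduling.wordBound κ p d) A (Scheduling.inputState p d) t s ∧
          IsLeast (Set.range (Scheduling.tardyTime p d)) (s.reg 0) ∧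
          (t : ℝ) ≤ C * (Scheduling.totalTime p : ℝ) ^ (7 / 4 : ℝ) *
            (1 + Real.log (Scheduling.totalTime p : ℝ)) ^ k := by
  -- The square in the word bound gives room for `2P + 4`, which covers sums of two totals; no
  -- logarithmic factor is needed.
  refine ⟨Scheduling.minTardy, 2, 0, 1400, fun n p d hn hp => ?_⟩
  set s₀ := Scheduling.inputState p d with hs₀
  set P := Scheduling.totalTime p with hPdef
  have hp₀ : ∀ j : Fin n, s₀.arr 0 j = p j := fun j => by
    simp [hs₀, Scheduling.inputState]
  have hd₀ : ∀ j : Fin n, s₀.arr 1 j = d j := fun j => by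
    simp [hs₀, Scheduling.inputState]
  have hP : ∑ i ∈ Finset.range n, s₀.arr 0 i = P := by
    rw [Finset.sum_range]
    exact Finset.sum_congr rfl fun j _ => hp₀ j
  have hnP : n ≤ P := by
    have := Finset.sum_le_sum (f := fun _ => 1) (g := p)
      fun (j : Fin n) (_ : j ∈ Finset.univ) => hp j
    simpa [hPdef, Scheduling.totalTime] using this
  have hWdef : Scheduling.wordBound 2 p d = (P + Finset.univ.sup d + 2) ^ 2 := rfl
  have hW : 2 * P + 4 ≤ Scheduling.wordBound 2 p d := by
    rw [hWdef, pow_two]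
    exact le_trans (by omega) (Nat.mul_le_mul_right (P + Finset.univ.sup d + 2)
      (show 2 ≤ P + Finset.univ.sup d + 2 by omega))
  have hdW : ∀ i < n, s₀.arr 1 i < Scheduling.wordBound 2 p d := fun i hi => by
    have h1 := hd₀ ⟨i, hi⟩
    have h2 : d ⟨i, hi⟩ ≤ Finset.univ.sup d := Finset.le_sup (Finset.mem_univ _)
    simp only at h1
    rw [hWdef, h1]
    exact lt_of_lt_of_le (by omega) (Nat.le_self_pow two_ne_zero _)
  obtain ⟨t, s, hexec, ⟨x, hx, hreach, hmax⟩, ht⟩ := Scheduling.runs_minTardy hW hP hnP hdW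
    (by simp [hs₀, Scheduling.inputState])
    (fun k hk => by simp [hs₀, Scheduling.inputState, hk]) rfl rfl
    (fun k hk i => by
      simp [hs₀, Scheduling.inputState, show k ≠ 0 by omega, show k ≠ 1 by omega])
  have hiff : ∀ y, Scheduling.Reach (s₀.arr 0) (fun i => min (s₀.arr 1 i) P) (Finset.range n) y ↔
      Scheduling.Reach p (fun j => min (d j) P) Finset.univ y := fun y => by
    rw [Scheduling.reach_range_iff]
    simp only [hp₀, hd₀]
  refine ⟨t, s, hexec, ?_, ?_⟩
  · rw [hx]
    exact Scheduling.isLeast_tardyTime p d ((hiff x).1 hreach)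
      fun y hy => hmax y ((hiff y).2 hy)
  · rw [pow_zero, mul_one]
    have hcard := Scheduling.card_image_sq_le (n := n) (s₀.arr 0) fun i hi => by
      have h1 := hp₀ ⟨i, hi⟩
      simp only at h1
      rw [h1]
      exact hp _
    rw [hP] at hcard
    exact Scheduling.time_bound (hn.trans_le hnP) hnP hcard ht
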